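/- Let $p$ be a prime. A *cyclotomic pro-$p$ pair* $\mathcal G=(G,\theta)$ is a pro-$p$ group $G$ together with an orientation, i.e. a continuous homomorphism $\theta\colon G\to\mathbb Z_p^\times$; $\theta$ (and $\mathcal G$) is called *torsion-free* if the image of $\theta$ is a torsion-free group. For $n\ge 1$ let $\mathbb Z_p(1)/p^n$ be the group $\mathbb Z_p/p^n$ with $G$-action $g\cdot z=\theta(g)z$. The pair is *Kummerian* if for every $n\ge1$ the natural map of (continuous) cohomology groups $$H^1(G,\mathbb Z_p(1)/p^n)\longrightarrow H^1(G,\mathbb Z_p(1)/p)$$ is surjective. Let $K(\mathcal G)$ be the closed subgroup of $G$ generated by the elements $h^{-\theta(g)}\,ghg^{-1}$ with $g\in G$ and $h\in\ker\theta$. For a closed normal subgroup $N\subseteq\ker\theta$ of $G$, $\mathcal G/N$ denotes the pair $(G/N,\bar\theta)$ with $\bar\theta$ induced by $\theta$. A *minimal presentation* $G=F/R$ of $G$ is a continuous surjective homomorphism $\pi\colon F\to G$ with kernel $R$, where $F$ is a free pro-$p$ group (of arbitrary rank) and $R$ is contained in the Frattini subgroup $\Phi(F)$, the closed subgroup generated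 by $p$-th powers and commutators. **Corollary 6.11.** (1) Let $\mathcal G=(G,\theta)$ be a torsion-free cyclotomic pro-$p$ pair and $N$ a closed normal subgroup of $G$ with $N\subseteq K(\mathcal G)$. Then $N\subseteq\ker\theta$, and $\mathcal G$ is Kummerian if and only if $\mathcal G/N$ is Kummerian. (2) Let $G$ be a pro-$p$ group and $G=F/R$ a minimal presentation with projection $\pi\colon F\to G$. For every torsion-free orientation $\theta$ of $G$, the pair $(G,\theta)$ is Kummerian if and only if $R\subseteq K(F,\theta\circ\pi)$. Consequently, there is a torsion-free orientation $\theta$ of $G$ such that $(G,\theta)$ is Kummerian if and only if there is a torsion-free orientation $\hat\theta\colon F\to\mathbb Z_p^\times$ with $R\subseteq K(F,\hat\theta)$. -/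

import Mathlib

open Filter Topology

universe u v

section ProP

/-- A pro-`p` group: a profinite group (compact, totally disconnected topological group) all of
whose open normal subgroups have index a power of `p`. -/
structure IsProP (p : ℕ) (G : Type u) [Group G] [TopologicalSpace G] : Prop where
  topologicalGroup : IsTopologicalGroup G
  compact : CompactSpace G
  totallyDisconnected : TotallyDisconnectedSpace G
  index_eq : ∀ U : Subgroup G, U.Normal → IsOpen (U : Set G) → ∃ k : ℕ, U.index = p ^ k

/-- `F` is a free pro-`p` group on the set `X`, embedded by `ι`. As usual the basis converges to `1`
(each neighbourhood of `1` contains all but finitely many basis elements), and every map from `X`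
to a pro-`p` group that converges to `1` extends uniquely to a continuous homomorphism. -/
structure IsFreeProPOn (p : ℕ) {F : Type u} [Group F] [TopologicalSpace F]
    {X : Type u} (ι : X → F) : Prop where
  isProP : IsProP p F
  tendsto_one : Tendsto ι cofinite (𝓝 1)
  existsUnique_lift : ∀ (H : Type u) [Group H] [TopologicalSpace H], IsProP p H →
    ∀ f : X → H, Tendsto f cofinite (𝓝 1) → ∃! φ : F →ₜ* H, ∀ x, φ (ι x) = f x

/-- `F` is a free pro-`p` group, of arbitrary (possibly infinite) rank. -/
def IsFreeProP (p : ℕ) (F : Type u) [Group F] [TopologicalSpace F] : Prop :=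
  ∃ (X : Type u) (ι : X → F), IsFreeProPOn p ι

/-- The Frattini subgroup `Φ(G) = G^p G'` of a pro-`p` group: the closed subgroup generated by all
`p`-th powers and all commutators. -/
def proPFrattini (p : ℕ) (G : Type u) [Group G] [TopologicalSpace G] [IsTopologicalGroup G] :
    Subgroup G :=
  (Subgroup.closure (Set.range (fun g : G => g ^ p) ∪ commutatorSet G)).topologicalClosure

/-- A minimal presentation `G = F/R` of a pro-`p` group `G`, given by the projection `π : F → G`
with kernel `R`: `F` is a free pro-`p` group, `π` is a continuous surjective homomorphism, and
`R ⊆ Φ(F)`. -/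
structure IsMinimalPresentation (p : ℕ) {F : Type u} [Group F] [TopologicalSpace F]
    [IsTopologicalGroup F] {G : Type v} [Group G] [TopologicalSpace G] (π : F →ₜ* G) : Prop where
  free : IsFreeProP p F
  surjective : Function.Surjective π
  ker_le : π.toMonoidHom.ker ≤ proPFrattini p F

end ProP

section H1

variable {G : Type u} [Group G] [TopologicalSpace G]
  {M : Type v} [AddCommGroup M] [TopologicalSpace M] [IsTopologicalAddGroup M]

/-- Continuous 1-cocycles `c : G → M`, where `G` acts on `M` through `ρ`. -/
def contCocycles₁ (ρ : G →* AddMonoid.End M) : AddSubgroup (G → M) where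
  carrier := {c | Continuous c ∧ ∀ g h, c (g * h) = c g + ρ g (c h)}
  zero_mem' := ⟨continuous_const, by simp⟩
  add_mem' := by
    rintro a b ⟨ha, ha'⟩ ⟨hb, hb'⟩
    refine ⟨ha.add hb, fun g h => ?_⟩
    simp only [Pi.add_apply, ha', hb', map_add]
    abel
  neg_mem' := by
    rintro a ⟨ha, ha'⟩
    refine ⟨ha.neg, fun g h => ?_⟩
    simp only [Pi.neg_apply, ha', map_neg]
    abel

/-- The 1-coboundaries `g ↦ g • m - m` among the continuous 1-cocycles. -/
def contCoboundaries₁ (ρ : G →* AddMonoid.End M) : AddSubgroup (contCocycles₁ ρ) where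
  carrier := {c | ∃ m : M, ∀ g, c.1 g = ρ g m - m}
  zero_mem' := ⟨0, by simp⟩
  add_mem' := by
    rintro a b ⟨m, hm⟩ ⟨m', hm'⟩
    refine ⟨m + m', fun g => ?_⟩
    simp only [AddSubgroup.coe_add, Pi.add_apply, hm, hm', map_add]
    abel
  neg_mem' := by
    rintro a ⟨m, hm⟩
    refine ⟨-m, fun g => ?_⟩
    simp only [AddSubgroup.coe_neg, Pi.neg_apply, hm, map_neg]
    abel

/-- The first continuous cohomology group `H¹(G, M)`. -/
abbrev ContH1 (ρ : G →* AddMonoid.End M) : Type (max u v) :=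
  contCocycles₁ ρ ⧸ contCoboundaries₁ ρ

variable {M' : Type v} [AddCommGroup M'] [TopologicalSpace M'] [IsTopologicalAddGroup M']

/-- The map on continuous 1-cocycles induced by a continuous equivariant homomorphism. -/
def contCocycles₁Map (ρ : G →* AddMonoid.End M) (ρ' : G →* AddMonoid.End M') (f : M →+ M')
    (hf : Continuous f) (hequiv : ∀ g m, f (ρ g m) = ρ' g (f m)) :
    contCocycles₁ ρ →+ contCocycles₁ ρ' where
  toFun c := ⟨fun g => f (c.1 g), hf.comp c.2.1, fun g h => by
    change f (c.1 (g * h)) = f (c.1 g) + ρ' g (f (c.1 h))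
    rw [c.2.2, map_add, hequiv]⟩
  map_zero' := by ext; simp
  map_add' a b := by ext; simp

/-- The map `H¹(G, M) → H¹(G, M')` induced by a continuous equivariant homomorphism. -/
def contH1Map (ρ : G →* AddMonoid.End M) (ρ' : G →* AddMonoid.End M') (f : M →+ M')
    (hf : Continuous f) (hequiv : ∀ g m, f (ρ g m) = ρ' g (f m)) :
    ContH1 ρ →+ ContH1 ρ' :=
  QuotientAddGroup.map _ _ (contCocycles₁Map ρ ρ' f hf hequiv) (by
    rintro c ⟨m, hm⟩
    refine ⟨f m, fun g => ?_⟩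
    change f (c.1 g) = _
    rw [hm, map_sub, hequiv])

end H1

section Pairs

/- A cyclotomic pro-`p` pair is a pro-`p` group `G` together with an orientation, that is, a
continuous homomorphism `θ : G →ₜ* ℤ_[p]ˣ`. -/
variable {p : ℕ} [Fact p.Prime] {G : Type u} [Group G] [TopologicalSpace G]

/-- The pair is torsion-free: the image of `θ` is a torsion-free group. -/
def IsTorsionFreeOrientation (θ : G →ₜ* ℤ_[p]ˣ) : Prop :=
  ∀ g : G, IsOfFinOrder (θ g) → θ g = 1

/-- The action of `G` on `ℤ_p(1)/p^n`, realized as `ZMod (p ^ n)`: `g • z = θ(g) z`. -/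
noncomputable def tateAction (θ : G →ₜ* ℤ_[p]ˣ) (n : ℕ) :
    G →* AddMonoid.End (ZMod (p ^ n)) where
  toFun g := AddMonoidHom.mulLeft (PadicInt.toZModPow n (θ g : ℤ_[p]))
  map_one' := by
    ext z
    change PadicInt.toZModPow n ((θ 1 : ℤ_[p]ˣ) : ℤ_[p]) * z = z
    simp
  map_mul' a b := by
    ext z
    change PadicInt.toZModPow n ((θ (a * b) : ℤ_[p]ˣ) : ℤ_[p]) * z =
      PadicInt.toZModPow n (θ a : ℤ_[p]) * (PadicInt.toZModPow n (θ b : ℤ_[p]) * z)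
    simp [mul_assoc]

/-- The map `H¹(G, ℤ_p(1)/p^n) → H¹(G, ℤ_p(1)/p^m)`, for `m ≤ n`, induced by the projection
`ℤ_p(1)/p^n → ℤ_p(1)/p^m`. -/
noncomputable def tateH1Map (θ : G →ₜ* ℤ_[p]ˣ) {m n : ℕ} (h : m ≤ n) :
    ContH1 (tateAction θ n) →+ ContH1 (tateAction θ m) :=
  contH1Map _ _ (ZMod.castHom (pow_dvd_pow p h) (ZMod (p ^ m))).toAddMonoidHom
    continuous_of_discreteTopology (fun g z => by
      change ZMod.castHom (pow_dvd_pow p h) (ZMod (p ^ m)) (PadicInt.toZModPow n (θ g : ℤ_[p]) * z) =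
        PadicInt.toZModPow m (θ g : ℤ_[p]) * ZMod.castHom (pow_dvd_pow p h) (ZMod (p ^ m)) z
      rw [map_mul, ← PadicInt.zmod_cast_comp_toZModPow m n h, RingHom.comp_apply])

/-- The pair `(G, θ)` is Kummerian: `H¹(G, ℤ_p(1)/p^n) → H¹(G, ℤ_p(1)/p)` is surjective for all
`n ≥ 1`. -/
def IsKummerian (θ : G →ₜ* ℤ_[p]ˣ) : Prop :=
  ∀ (n : ℕ) (hn : 1 ≤ n), Function.Surjective (tateH1Map θ hn)

/-- The `p`-adic power `x ^ a` of an element of a pro-`p` group: the limit of the powers `x ^ k`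
as the natural number `k` tends to `a` in `ℤ_p`. -/
noncomputable def padicPow (x : G) (a : ℤ_[p]) : G :=
  @limUnder G _ ℕ ⟨1⟩ (comap (fun k : ℕ => (k : ℤ_[p])) (𝓝 a)) (fun k => x ^ k)

/-- The closed subgroup `K(𝒢)` of a pair `𝒢 = (G, θ)`, generated by the elements
`h^{-θ(g)} g h g⁻¹` with `g ∈ G` and `h ∈ Ker θ`. -/
noncomputable def kSubgroup [IsTopologicalGroup G] (θ : G →ₜ* ℤ_[p]ˣ) : Subgroup G :=
  (Subgroup.closure {x : G | ∃ g h : G, h ∈ θ.toMonoidHom.ker ∧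
    x = padicPow h (-(θ g : ℤ_[p])) * (g * h * g⁻¹)}).topologicalClosure

/-- The orientation of `G/N` induced by `θ`, for a normal subgroup `N ⊆ Ker θ`. -/
noncomputable def quotientOrientation (θ : G →ₜ* ℤ_[p]ˣ) (N : Subgroup G) [N.Normal]
    (hN : N ≤ θ.toMonoidHom.ker) : (G ⧸ N) →ₜ* ℤ_[p]ˣ where
  toMonoidHom := QuotientGroup.lift N θ.toMonoidHom hN
  continuous_toFun := θ.continuous_toFun.quotient_lift _

end Pairs

/-! Everything is read off from continuous cocycles `c : G → ℤ_p(1)/p^n`. On `ker θ` such a `c` is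
an equivariant homomorphism, so it kills `h^{-θ(g)} g h g⁻¹` and hence all of `K(𝒢)`
(`IsTateCocycle.eq_zero_of_mem_kSubgroup`). Dividing by a normal subgroup inside `K(𝒢)` therefore
leaves the cocycles of every level unchanged, and with them Kummerianity
(`isKummerian_iff_of_ker_le_kSubgroup`); this is (1).

For (2), a free pro-`p` group is Kummerian for every orientation, because cocycles can be prescribed
on a basis (`IsFreeProPOn.isKummerian`). If `R ⊆ K(F, θ ∘ π)`, this property passes to `G`.
Conversely, if `G` is Kummerian and `R ⊆ Φ(F)`, induction on `n` shows that all cocycles of `F`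
vanish on `R` (`IsKummerian.eq_zero_of_mem_ker`). Cocycles detect `K` when `θ` is torsion-free: the
image of `θ` is then procyclic, `F → F / ker θ` splits, and equivariant characters of `ker θ` extend
to cocycles of `F`. -/

theorem IsProP.t1Space {p : ℕ} {G : Type u} [Group G] [TopologicalSpace G] (hG : IsProP p G) :
    T1Space G :=
  have := hG.totallyDisconnected
  inferInstance

theorem IsProP.t2Space {p : ℕ} {G : Type u} [Group G] [TopologicalSpace G] (hG : IsProP p G) :
    T2Space G :=
  have := hG.t1Space
  have := hG.topologicalGroup
  inferInstance

theorem IsProP.exists_openNormal_le {p : ℕ} {G : Type u} [Group G] [TopologicalSpace G]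
    (hG : IsProP p G) {W : Set G} (hW : W ∈ 𝓝 (1 : G)) :
    ∃ U : Subgroup G, U.Normal ∧ IsOpen (U : Set G) ∧ (U : Set G) ⊆ W := by
  have := hG.topologicalGroup
  have := hG.compact
  have := hG.totallyDisconnected
  have := hG.t2Space
  obtain ⟨V, hVW, hV, h1⟩ := mem_nhds_iff.1 hW
  obtain ⟨H, hH⟩ := ProfiniteGrp.exist_openNormalSubgroup_sub_open_nhds_of_one hV h1
  exact ⟨H.toSubgroup, H.isNormal', H.isOpen', hH.trans hVW⟩

/-! ### `p`-adic powers in pro-`p` groups. -/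

section PadicPow

variable {p : ℕ} [Fact p.Prime] {G : Type u} [Group G] [TopologicalSpace G]

instance comap_natCast_nhds_neBot (a : ℤ_[p]) :
    (comap (fun k : ℕ => (k : ℤ_[p])) (𝓝 a)).NeBot :=
  comap_neBot fun _ ht => (PadicInt.denseRange_natCast (p := p)).exists_mem_open
    isOpen_interior ⟨a, mem_interior_iff_mem_nhds.2 ht⟩ |>.imp fun _ h => interior_subset h

theorem PadicInt.isOpen_toZModPow_preimage (n : ℕ) (s : Set (ZMod (p ^ n))) :
    IsOpen (PadicInt.toZModPow (p := p) n ⁻¹' s) := by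
  rw [isOpen_iff_mem_nhds]
  intro a ha
  have hp : (0 : ℝ) < (p : ℝ) ^ (-(n : ℤ)) := zpow_pos (by exact_mod_cast (Fact.out : p.Prime).pos) _
  filter_upwards [Metric.closedBall_mem_nhds a hp] with b hb
  have h : b - a ∈ RingHom.ker (PadicInt.toZModPow (p := p) n) := by
    rw [PadicInt.ker_toZModPow, ← PadicInt.norm_le_pow_iff_mem_span_pow, ← dist_eq_norm]
    exact hb
  rw [RingHom.mem_ker, map_sub, sub_eq_zero] at h
  simpa [h] using ha

theorem PadicInt.continuous_toZModPow (n : ℕ) : Continuous (PadicInt.toZModPow (p := p) n) :=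
  continuous_def.2 fun s _ => PadicInt.isOpen_toZModPow_preimage n s

/-- Modulo `U` the power `x ^ k` depends only on `k` mod the index `p ^ n`, and this residue is
eventually constant as `k → a`. -/
theorem IsProP.eventually_pow_mem (hG : IsProP p G) (x : G) (a : ℤ_[p]) {U : Subgroup G}
    (hU : U.Normal) (hUo : IsOpen (U : Set G)) :
    ∃ y : G, ∀ᶠ k : ℕ in comap (fun k : ℕ => (k : ℤ_[p])) (𝓝 a), y⁻¹ * x ^ k ∈ U := by
  obtain ⟨n, hn⟩ := hG.index_eq U hU hUo
  have hev : ∀ᶠ k : ℕ in comap (fun k : ℕ => (k : ℤ_[p])) (𝓝 a),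
      (k : ZMod (p ^ n)) = PadicInt.toZModPow n a := by
    have := (PadicInt.continuous_toZModPow n).tendsto a
    rw [nhds_discrete (ZMod _), tendsto_pure] at this
    filter_upwards [tendsto_comap.eventually this] with k hk
    simpa using hk
  obtain ⟨l, hl⟩ := hev.exists
  refine ⟨x ^ l, ?_⟩
  filter_upwards [hev] with k hk
  rw [← hl, ZMod.natCast_eq_natCast_iff, ← hn] at hk
  have hx : (x : G ⧸ U) ^ U.index = 1 := by
    rw [← QuotientGroup.mk_pow, QuotientGroup.eq_one_iff]
    exact U.pow_index_mem x
  rw [← QuotientGroup.eq, QuotientGroup.mk_pow, QuotientGroup.mk_pow]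
  exact pow_eq_pow_of_modEq hk.symm hx

variable [IsTopologicalGroup G]

theorem IsProP.tendsto_padicPow (hG : IsProP p G) (x : G) (a : ℤ_[p]) :
    Tendsto (fun k : ℕ => x ^ k) (comap (fun k : ℕ => (k : ℤ_[p])) (𝓝 a)) (𝓝 (padicPow x a)) := by
  have := hG.compact
  have := hG.t2Space
  refine tendsto_nhds_limUnder ?_
  set l := comap (fun k : ℕ => (k : ℤ_[p])) (𝓝 a)
  -- Compactness gives a cluster point; two cluster points agree modulo every open normal subgroup,
  -- so it is unique and is the limit.
  obtain ⟨y, hy⟩ := exists_clusterPt_of_compactSpace (map (fun k : ℕ => x ^ k) l)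
  refine ⟨y, le_nhds_of_unique_clusterPt fun z hz => ?_⟩
  by_contra hne
  have hW : {w : G | w ≠ z⁻¹ * y} ∈ 𝓝 (1 : G) :=
    isOpen_ne.mem_nhds fun h => hne (by rw [← mul_one z, h]; group)
  obtain ⟨U, hU, hUo, hUW⟩ := hG.exists_openNormal_le hW
  obtain ⟨w, hw⟩ := hG.eventually_pow_mem x a hU hUo
  have key : ∀ t, ClusterPt t (map (fun k : ℕ => x ^ k) l) → w⁻¹ * t ∈ U := fun t ht => by
    have hc : IsClosed {t : G | w⁻¹ * t ∈ U} :=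
      (Subgroup.isClosed_of_isOpen U hUo).preimage (continuous_const_mul w⁻¹)
    exact hc.closure_subset (mem_closure_iff_clusterPt.2 (ht.mono (le_principal_iff.2 hw)))
  refine hUW ?_ (rfl : z⁻¹ * y = z⁻¹ * y)
  have := U.mul_mem (U.inv_mem (key z hz)) (key y hy)
  simpa [mul_assoc] using this

theorem IsProP.padicPow_natCast (hG : IsProP p G) (x : G) (k : ℕ) :
    padicPow x (k : ℤ_[p]) = x ^ k := by
  have := hG.t1Space
  by_contra hne
  have h := hG.tendsto_padicPow x (k : ℤ_[p])
  have h2 : pure k ≤ comap (fun k : ℕ => (k : ℤ_[p])) (𝓝 (k : ℤ_[p])) := by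
    rw [← map_le_iff_le_comap, map_pure]
    exact pure_le_nhds _
  have h3 : Tendsto (fun k : ℕ => x ^ k) (pure k) (pure (x ^ k)) := tendsto_pure_pure _ _
  exact hne (tendsto_nhds_unique (h.mono_left h2) (h3.mono_right (pure_le_nhds _)))

theorem IsProP.padicPow_add (hG : IsProP p G) (x : G) (a b : ℤ_[p]) :
    padicPow x (a + b) = padicPow x a * padicPow x b := by
  have := hG.t1Space
  have hadd : Tendsto (fun q : ℕ × ℕ => q.1 + q.2)
      (comap (fun k : ℕ => (k : ℤ_[p])) (𝓝 a) ×ˢ comap (fun k : ℕ => (k : ℤ_[p])) (𝓝 b))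
      (comap (fun k : ℕ => (k : ℤ_[p])) (𝓝 (a + b))) := by
    rw [tendsto_comap_iff]
    have := (tendsto_comap (f := fun k : ℕ => (k : ℤ_[p])) (x := 𝓝 a)).comp
      (tendsto_fst (g := comap (fun k : ℕ => (k : ℤ_[p])) (𝓝 b)))
    have h2 := (tendsto_comap (f := fun k : ℕ => (k : ℤ_[p])) (x := 𝓝 b)).comp
      (tendsto_snd (f := comap (fun k : ℕ => (k : ℤ_[p])) (𝓝 a)))
    simpa [Function.comp_def] using this.add h2
  have h1 := (hG.tendsto_padicPow x (a + b)).comp hadd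
  have h2 := ((hG.tendsto_padicPow x a).comp tendsto_fst).mul
    ((hG.tendsto_padicPow x b).comp tendsto_snd)
  refine tendsto_nhds_unique h1 (h2.congr fun q => ?_)
  simp [pow_add]

theorem IsProP.continuous_padicPow (hG : IsProP p G) (x : G) :
    Continuous (padicPow x : ℤ_[p] → G) := by
  have := hG.t1Space
  -- With `ℕ` carrying the `p`-adic topology, `padicPow x` is by definition the extension by density
  -- of `k ↦ x ^ k`.
  let : TopologicalSpace ℕ := TopologicalSpace.induced (fun k : ℕ => (k : ℤ_[p])) inferInstance
  have di : IsDenseInducing (fun k : ℕ => (k : ℤ_[p])) := ⟨⟨rfl⟩, PadicInt.denseRange_natCast⟩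
  exact di.continuous_extend fun a => ⟨_, hG.tendsto_padicPow x a⟩

/-- Allows locally constant data to be computed on an ordinary power whose exponent has the right
residue. -/
theorem IsProP.exists_pow_eq_padicPow (hG : IsProP p G) (x : G) (a : ℤ_[p]) (n : ℕ) {W : Set G}
    (hW : W ∈ 𝓝 (padicPow x a)) :
    ∃ k : ℕ, x ^ k ∈ W ∧ (k : ZMod (p ^ n)) = PadicInt.toZModPow n a := by
  have := (PadicInt.continuous_toZModPow n).tendsto a
  rw [nhds_discrete (ZMod _), tendsto_pure] at this
  obtain ⟨k, hk⟩ := ((hG.tendsto_padicPow x a).eventually hW |>.and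
    (tendsto_comap.eventually this)).exists
  exact ⟨k, hk.1, by simpa using hk.2⟩

theorem IsProP.padicPow_mem (hG : IsProP p G) {H : Subgroup G} (hH : IsClosed (H : Set G)) {x : G}
    (hx : x ∈ H) (a : ℤ_[p]) : padicPow x a ∈ H :=
  hH.mem_of_tendsto (hG.tendsto_padicPow x a) (Eventually.of_forall fun k => H.pow_mem hx k)

theorem IsProP.conj_padicPow (hG : IsProP p G) (g x : G) (a : ℤ_[p]) :
    g * padicPow x a * g⁻¹ = padicPow (g * x * g⁻¹) a := by
  have := hG.t1Space
  refine tendsto_nhds_unique (((hG.tendsto_padicPow x a).const_mul g).mul_const g⁻¹)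
    ((hG.tendsto_padicPow (g * x * g⁻¹) a).congr fun k => ?_)
  exact conj_pow

end PadicPow

/-! ### Cocycles with values in `ℤ_p(1)/p^n`, and the subgroup `K(𝒢)`. -/

section TateCocycle

variable {p : ℕ} [Fact p.Prime] {G : Type u} [Group G] [TopologicalSpace G]

/-- Continuous 1-cocycles of `G` with values in `ℤ_p(1)/p^n`. -/
structure IsTateCocycle (θ : G →ₜ* ℤ_[p]ˣ) (n : ℕ) (c : G → ZMod (p ^ n)) : Prop where
  continuous : Continuous c
  map_mul : ∀ g h, c (g * h) = c g + PadicInt.toZModPow n (θ g : ℤ_[p]) * c h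

theorem mem_contCocycles₁_tateAction {θ : G →ₜ* ℤ_[p]ˣ} {n : ℕ} {c : G → ZMod (p ^ n)} :
    c ∈ contCocycles₁ (tateAction θ n) ↔ IsTateCocycle θ n c :=
  ⟨fun h => ⟨h.1, h.2⟩, fun h => ⟨h.1, h.2⟩⟩

/-- A lift of a class is a lift of the cocycle up to a coboundary, and coboundaries lift since
`ℤ/p^n → ℤ/p` is surjective. -/
theorem isKummerian_iff {θ : G →ₜ* ℤ_[p]ˣ} :
    IsKummerian θ ↔ ∀ (n : ℕ) (hn : 1 ≤ n) (c : G → ZMod (p ^ 1)), IsTateCocycle θ 1 c →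
      ∃ d : G → ZMod (p ^ n), IsTateCocycle θ n d ∧
        ∀ g, ZMod.castHom (pow_dvd_pow p hn) (ZMod (p ^ 1)) (d g) = c g := by
  constructor
  · intro H n hn c hc
    obtain ⟨x, hx⟩ := H n hn (QuotientAddGroup.mk ⟨c, mem_contCocycles₁_tateAction.2 hc⟩)
    obtain ⟨d, rfl⟩ := QuotientAddGroup.mk_surjective x
    obtain ⟨m, hm⟩ := QuotientAddGroup.eq.1 hx
    obtain ⟨m', rfl⟩ := ZMod.castHom_surjective (pow_dvd_pow p hn) m
    have hb : IsTateCocycle θ n fun g => d.1 g +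
        (PadicInt.toZModPow n (θ g : ℤ_[p]) * m' - m') := by
      refine ⟨d.2.1.add ?_, fun g h => ?_⟩
      · exact (((PadicInt.continuous_toZModPow n).comp
          (Units.continuous_val.comp θ.continuous_toFun)).mul continuous_const).sub continuous_const
      · have := (mem_contCocycles₁_tateAction.1 d.2).map_mul g h
        rw [this]
        simp only [map_mul, Units.val_mul]
        ring
    refine ⟨_, hb, fun g => ?_⟩
    have h1 : -(ZMod.castHom (pow_dvd_pow p hn) (ZMod (p ^ 1)) (d.1 g)) + c g =
      PadicInt.toZModPow 1 (θ g : ℤ_[p]) * ZMod.castHom (pow_dvd_pow p hn) (ZMod (p ^ 1)) m' -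
        ZMod.castHom (pow_dvd_pow p hn) (ZMod (p ^ 1)) m' := hm g
    rw [map_add, map_sub, map_mul, ← RingHom.comp_apply, PadicInt.zmod_cast_comp_toZModPow 1 n hn,
      ← h1]
    ring
  · intro H n hn x
    obtain ⟨c, rfl⟩ := QuotientAddGroup.mk_surjective x
    obtain ⟨d, hd, hdc⟩ := H n hn c.1 (mem_contCocycles₁_tateAction.1 c.2)
    refine ⟨QuotientAddGroup.mk ⟨d, mem_contCocycles₁_tateAction.2 hd⟩, ?_⟩
    exact congrArg QuotientAddGroup.mk (Subtype.ext (funext hdc))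

namespace IsTateCocycle

variable {θ : G →ₜ* ℤ_[p]ˣ} {n : ℕ} {c : G → ZMod (p ^ n)}

theorem map_one (hc : IsTateCocycle θ n c) : c 1 = 0 := by
  simpa using hc.map_mul 1 1

theorem map_ker_mul (hc : IsTateCocycle θ n c) {g : G} (hg : θ g = 1) (h : G) :
    c (g * h) = c g + c h := by
  simp [hc.map_mul, hg]

theorem map_pow (hc : IsTateCocycle θ n c) {g : G} (hg : θ g = 1) (k : ℕ) :
    c (g ^ k) = k * c g := by
  induction k with
  | zero => simp [hc.map_one]
  | succ k ih => rw [pow_succ', hc.map_ker_mul hg, ih]; push_cast; ring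

theorem map_conj (hc : IsTateCocycle θ n c) (g : G) {h : G} (hh : θ h = 1) :
    c (g * h * g⁻¹) = PadicInt.toZModPow n (θ g : ℤ_[p]) * c h := by
  have h1 : θ (g * h * g⁻¹) = 1 := by simp [hh]
  have h2 := hc.map_ker_mul h1 g
  rw [inv_mul_cancel_right, hc.map_mul] at h2
  linear_combination -h2

theorem map_padicPow [IsTopologicalGroup G] (hG : IsProP p G) (hc : IsTateCocycle θ n c) {h : G}
    (hh : θ h = 1) (a : ℤ_[p]) : c (padicPow h a) = PadicInt.toZModPow n a * c h := by
  obtain ⟨k, hk, hka⟩ := hG.exists_pow_eq_padicPow h a n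
    (hc.continuous.continuousAt.preimage_mem_nhds (t := {c (padicPow h a)}) (by simp))
  rw [Set.mem_preimage, Set.mem_singleton_iff, hc.map_pow hh, hka] at hk
  exact hk.symm

end IsTateCocycle

section Descent

variable {F : Type v} [Group F] [TopologicalSpace F] {θF : F →ₜ* ℤ_[p]ˣ} {θ : G →ₜ* ℤ_[p]ˣ}
  {π : F →* G} {n : ℕ}

theorem IsTateCocycle.comp {d : G → ZMod (p ^ n)} (hd : IsTateCocycle θ n d) (hπ : Continuous π)
    (hθ : ∀ x, θ (π x) = θF x) : IsTateCocycle θF n (d ∘ π) :=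
  ⟨hd.continuous.comp hπ, fun g h => by simp [hd.map_mul, hθ]⟩

/-- The identity `c (x * r) = c x + θ(x) c r` makes `c` constant on the fibres of `π`. -/
theorem IsTateCocycle.exists_descent {c : F → ZMod (p ^ n)} (hc : IsTateCocycle θF n c)
    (hπ : IsQuotientMap π) (hθ : ∀ x, θ (π x) = θF x) (hker : ∀ r ∈ π.ker, c r = 0) :
    ∃ d, IsTateCocycle θ n d ∧ ∀ x, d (π x) = c x := by
  have hfac : ∀ x y, π x = π y → c x = c y := fun x y hxy => by
    have h1 : x⁻¹ * y ∈ π.ker := by simp [MonoidHom.mem_ker, hxy]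
    have h2 := hc.map_mul x (x⁻¹ * y)
    rw [mul_inv_cancel_left, hker _ h1, mul_zero, add_zero] at h2
    exact h2.symm
  refine ⟨fun g => c (Function.surjInv hπ.surjective g), ?_, ?_⟩
  · have h3 : ∀ x, c (Function.surjInv hπ.surjective (π x)) = c x := fun x =>
      hfac _ _ (Function.surjInv_eq hπ.surjective _)
    refine ⟨?_, fun g h => ?_⟩
    · rw [hπ.continuous_iff]
      exact hc.continuous.congr fun x => (h3 x).symm
    · obtain ⟨x, rfl⟩ := hπ.surjective g
      obtain ⟨y, rfl⟩ := hπ.surjective h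
      rw [← _root_.map_mul π, h3, h3, h3, hc.map_mul, hθ]
  · exact fun x => hfac _ _ (Function.surjInv_eq hπ.surjective _)

end Descent

theorem isClosed_orientation_ker (θ : G →ₜ* ℤ_[p]ˣ) :
    IsClosed (θ.toMonoidHom.ker : Set G) :=
  isClosed_singleton.preimage θ.continuous_toFun

theorem mem_orientation_ker {θ : G →ₜ* ℤ_[p]ˣ} {g : G} : g ∈ θ.toMonoidHom.ker ↔ θ g = 1 :=
  Iff.rfl

section KSubgroup

variable [IsTopologicalGroup G]

theorem kSubgroup_le_of_isClosed {θ : G →ₜ* ℤ_[p]ˣ} {L : Subgroup G} (hL : IsClosed (L : Set G))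
    (h : ∀ g h : G, θ h = 1 → padicPow h (-(θ g : ℤ_[p])) * (g * h * g⁻¹) ∈ L) :
    kSubgroup θ ≤ L := by
  refine Subgroup.topologicalClosure_minimal _ ?_ hL
  rw [Subgroup.closure_le]
  rintro _ ⟨x, y, hy, rfl⟩
  exact h x y hy

theorem mem_kSubgroup {θ : G →ₜ* ℤ_[p]ˣ} (g : G) {h : G} (hh : θ h = 1) :
    padicPow h (-(θ g : ℤ_[p])) * (g * h * g⁻¹) ∈ kSubgroup θ :=
  Subgroup.le_topologicalClosure _ (Subgroup.subset_closure ⟨g, h, hh, rfl⟩)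

theorem isClosed_kSubgroup (θ : G →ₜ* ℤ_[p]ˣ) : IsClosed (kSubgroup θ : Set G) :=
  Subgroup.isClosed_topologicalClosure _

theorem kSubgroup_le_ker (hG : IsProP p G) (θ : G →ₜ* ℤ_[p]ˣ) :
    kSubgroup θ ≤ θ.toMonoidHom.ker := by
  refine kSubgroup_le_of_isClosed (isClosed_orientation_ker θ) fun g h hh => ?_
  refine Subgroup.mul_mem _ (hG.padicPow_mem (isClosed_orientation_ker θ) hh _) ?_
  exact Subgroup.Normal.conj_mem inferInstance h hh g

theorem kSubgroup_normal (hG : IsProP p G) (θ : G →ₜ* ℤ_[p]ˣ) : (kSubgroup θ).Normal := by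
  refine ⟨fun y hy x => ?_⟩
  have hL : IsClosed (((kSubgroup θ).comap (MulAut.conj x).toMonoidHom : Subgroup G) : Set G) := by
    have : Continuous fun z : G => x * z * x⁻¹ := by fun_prop
    exact (isClosed_kSubgroup θ).preimage this
  refine kSubgroup_le_of_isClosed hL (fun g h hh => ?_) hy
  -- Conjugation by `x` sends the generator attached to `(g, h)` to the one attached to `(x g x⁻¹, x
  -- h x⁻¹)`.
  have h1 := mem_kSubgroup (θ := θ) (x * g * x⁻¹) (h := x * h * x⁻¹) (by simp [hh])
  have h2 : θ (x * g * x⁻¹) = θ g := by simp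
  rw [h2, ← hG.conj_padicPow] at h1
  change x * (padicPow h (-(θ g : ℤ_[p])) * (g * h * g⁻¹)) * x⁻¹ ∈ kSubgroup θ
  convert h1 using 1
  group

/-- On a generator the value is `-θ(g) c(h) + θ(g) c(h) = 0`. -/
theorem IsTateCocycle.eq_zero_of_mem_kSubgroup (hG : IsProP p G) {θ : G →ₜ* ℤ_[p]ˣ} {n : ℕ}
    {c : G → ZMod (p ^ n)} (hc : IsTateCocycle θ n c) {h : G} (hh : h ∈ kSubgroup θ) : c h = 0 := by
  let L : Subgroup G :=
    { carrier := {x | θ x = 1 ∧ c x = 0}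
      one_mem' := ⟨_root_.map_one θ, hc.map_one⟩
      mul_mem' := fun {a b} ha hb => ⟨by simp [ha.1, hb.1], by
        rw [hc.map_ker_mul ha.1, ha.2, hb.2, add_zero]⟩
      inv_mem' := fun {a} ha => ⟨by simp [ha.1], by
        have := hc.map_ker_mul ha.1 a⁻¹
        rwa [mul_inv_cancel, hc.map_one, ha.2, zero_add, eq_comm] at this⟩ }
  have hL : IsClosed (L : Set G) :=
    (isClosed_orientation_ker θ).inter (isClosed_singleton.preimage hc.continuous)
  refine (kSubgroup_le_of_isClosed (L := L) hL (fun x y hy => ?_) hh).2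
  have h1 : θ (padicPow y (-(θ x : ℤ_[p]))) = 1 :=
    hG.padicPow_mem (isClosed_orientation_ker θ) hy _
  refine ⟨by simp [h1, hy], ?_⟩
  rw [hc.map_ker_mul h1, hc.map_conj x hy, hc.map_padicPow hG hy]
  simp

end KSubgroup

theorem isKummerian_iff_of_ker_le_kSubgroup {F : Type v} [Group F] [TopologicalSpace F]
    {θF : F →ₜ* ℤ_[p]ˣ} {θ : G →ₜ* ℤ_[p]ˣ} {π : F →* G} [IsTopologicalGroup F] (hF : IsProP p F)
    (hπ : IsQuotientMap π) (hθ : ∀ x, θ (π x) = θF x) (hker : π.ker ≤ kSubgroup θF) :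
    IsKummerian θF ↔ IsKummerian θ := by
  rw [isKummerian_iff, isKummerian_iff]
  constructor
  · intro H n hn c hc
    obtain ⟨d, hd, hdc⟩ := H n hn _ (hc.comp hπ.continuous hθ)
    obtain ⟨e, he, hed⟩ := hd.exists_descent hπ hθ
      fun r hr => hd.eq_zero_of_mem_kSubgroup hF (hker hr)
    refine ⟨e, he, fun g => ?_⟩
    obtain ⟨x, rfl⟩ := hπ.surjective g
    rw [hed, hdc, Function.comp_apply]
  · intro H n hn c hc
    obtain ⟨c', hc', hcc⟩ := hc.exists_descent hπ hθ
      fun r hr => hc.eq_zero_of_mem_kSubgroup hF (hker hr)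
    obtain ⟨d, hd, hdc⟩ := H n hn _ hc'
    exact ⟨_, hd.comp hπ.continuous hθ, fun g => by rw [Function.comp_apply, hdc, hcc]⟩

end TateCocycle

/-! ### Free pro-`p` groups are Kummerian for every orientation. -/

section FreeProP

variable {p : ℕ} [Fact p.Prime] {F : Type u} [Group F] [TopologicalSpace F]

/-- The semidirect product `ℤ_p(1)/p^n ⋊ F`. -/
def TateSemidirect (_θ : F →ₜ* ℤ_[p]ˣ) (n : ℕ) : Type u := ZMod (p ^ n) × F

namespace TateSemidirect

variable {θ : F →ₜ* ℤ_[p]ˣ} {n : ℕ}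

instance : TopologicalSpace (TateSemidirect θ n) :=
  inferInstanceAs (TopologicalSpace (ZMod (p ^ n) × F))

noncomputable instance : Group (TateSemidirect θ n) where
  mul a b := (a.1 + PadicInt.toZModPow n (θ a.2 : ℤ_[p]) * b.1, a.2 * b.2)
  one := (0, 1)
  inv a := (-(PadicInt.toZModPow n (θ a.2⁻¹ : ℤ_[p]) * a.1), a.2⁻¹)
  mul_assoc a b c := Prod.ext
    (show a.1 + _ * b.1 + PadicInt.toZModPow n (θ (a.2 * b.2) : ℤ_[p]) * c.1 =
        a.1 + PadicInt.toZModPow n (θ a.2 : ℤ_[p]) *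
          (b.1 + PadicInt.toZModPow n (θ b.2 : ℤ_[p]) * c.1) by
      simp only [map_mul, Units.val_mul]; ring) (mul_assoc a.2 b.2 c.2)
  one_mul a := Prod.ext (show 0 + PadicInt.toZModPow n (θ 1 : ℤ_[p]) * a.1 = a.1 by simp)
    (one_mul a.2)
  mul_one a := Prod.ext (show a.1 + PadicInt.toZModPow n (θ a.2 : ℤ_[p]) * 0 = a.1 by simp)
    (mul_one a.2)
  inv_mul_cancel a := Prod.ext (show -(PadicInt.toZModPow n (θ a.2⁻¹ : ℤ_[p]) * a.1) +
    PadicInt.toZModPow n (θ a.2⁻¹ : ℤ_[p]) * a.1 = 0 by ring) (inv_mul_cancel a.2)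

theorem fst_mul (a b : TateSemidirect θ n) :
    (a * b).1 = a.1 + PadicInt.toZModPow n (θ a.2 : ℤ_[p]) * b.1 := rfl

theorem continuous_action (θ : F →ₜ* ℤ_[p]ˣ) (n : ℕ) :
    Continuous fun g => PadicInt.toZModPow n (θ g : ℤ_[p]) :=
  (PadicInt.continuous_toZModPow n).comp (Units.continuous_val.comp θ.continuous_toFun)

instance [IsTopologicalGroup F] : IsTopologicalGroup (TateSemidirect θ n) where
  continuous_mul := by
    have h : Continuous fun q : (ZMod (p ^ n) × F) × ZMod (p ^ n) × F =>
        (q.1.1 + PadicInt.toZModPow n (θ q.1.2 : ℤ_[p]) * q.2.1, q.1.2 * q.2.2) := by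
      have := (continuous_action θ n).comp (f := fun q : (ZMod (p ^ n) × F) × ZMod (p ^ n) × F =>
        q.1.2) (by fun_prop)
      exact ((by fun_prop : Continuous _).add (this.mul (by fun_prop))).prodMk (by fun_prop)
    exact h
  continuous_inv := by
    have h : Continuous fun q : ZMod (p ^ n) × F =>
        (-(PadicInt.toZModPow n (θ q.2⁻¹ : ℤ_[p]) * q.1), q.2⁻¹) := by
      have := (continuous_action θ n).comp (f := fun q : ZMod (p ^ n) × F => q.2⁻¹) (by fun_prop)
      exact (this.mul (by fun_prop)).neg.prodMk (by fun_prop)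
    exact h

variable (θ n) in
/-- The projection `ℤ_p(1)/p^n ⋊ F → F`. -/
noncomputable def proj : TateSemidirect θ n →ₜ* F where
  toFun a := a.2
  map_one' := rfl
  map_mul' _ _ := rfl
  continuous_toFun := continuous_snd

theorem pow_eq_one_of_proj_eq_one {a : TateSemidirect θ n} (ha : proj θ n a = 1) :
    a ^ p ^ n = 1 := by
  have h : ∀ k : ℕ, a ^ k = ((k * a.1, 1) : ZMod (p ^ n) × F) := fun k => by
    induction k with
    | zero => exact Prod.ext (by simp; rfl) rfl
    | succ k ih =>
      have h2 : a.2 = 1 := ha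
      refine Prod.ext ?_ ?_
      · rw [pow_succ', fst_mul, h2, ih]
        simp
        ring
      · rw [pow_succ', ih]
        change a.2 * 1 = 1
        rw [h2, mul_one]
  rw [h]
  exact Prod.ext (by simp; rfl) rfl

theorem isProP [IsTopologicalGroup F] (hF : IsProP p F) : IsProP p (TateSemidirect θ n) := by
  have := hF.compact
  have := hF.totallyDisconnected
  have : CompactSpace (TateSemidirect θ n) := inferInstanceAs (CompactSpace (ZMod (p ^ n) × F))
  refine ⟨inferInstance, this,
    inferInstanceAs (TotallyDisconnectedSpace (ZMod (p ^ n) × F)), fun U hU hUo => ?_⟩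
  have hfin : Finite (TateSemidirect θ n ⧸ U) := Subgroup.quotient_finite_of_isOpen U hUo
  have hsurj : Function.Surjective (proj θ n).toMonoidHom := fun g => ⟨(0, g), rfl⟩
  have hV : (U.map (proj θ n).toMonoidHom).Normal := hU.map _ hsurj
  have hVo : IsOpen ((U.map (proj θ n).toMonoidHom : Subgroup F) : Set F) :=
    isOpenMap_snd (X := ZMod (p ^ n)) (Y := F) _ hUo
  obtain ⟨k, hk⟩ := hF.index_eq _ hV hVo
  refine IsPGroup.iff_card.1 fun q => ?_
  obtain ⟨a, rfl⟩ := QuotientGroup.mk_surjective q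
  have ha : proj θ n a ^ p ^ k ∈ U.map (proj θ n).toMonoidHom := hk ▸ Subgroup.pow_index_mem _ _
  obtain ⟨b, hb, hba⟩ := ha
  -- The power `p ^ k` moves `a` into the kernel `ℤ/p^n` of the projection modulo `U`, and `p ^ n`
  -- kills that kernel.
  refine ⟨k + n, ?_⟩
  have h1 : ((b⁻¹ * a ^ p ^ k) ^ p ^ n : TateSemidirect θ n) = 1 := by
    refine pow_eq_one_of_proj_eq_one ?_
    have hba' : proj θ n b = proj θ n a ^ p ^ k := hba
    rw [map_mul, map_inv, map_pow, hba', inv_mul_cancel]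
  have h2 : (QuotientGroup.mk (b⁻¹ * a ^ p ^ k) : TateSemidirect θ n ⧸ U) =
      (QuotientGroup.mk a) ^ p ^ k := by
    rw [QuotientGroup.mk_mul, QuotientGroup.mk_inv, (QuotientGroup.eq_one_iff b).2 hb,
      QuotientGroup.mk_pow, inv_one, one_mul]
  rw [pow_add, pow_mul, ← h2, ← QuotientGroup.mk_pow, h1, QuotientGroup.mk_one]

end TateSemidirect

open TateSemidirect in
/-- A cocycle, seen as a section of the projection `ℤ_p(1)/p^n ⋊ F → F`. -/
noncomputable def IsTateCocycle.toSection {θ : F →ₜ* ℤ_[p]ˣ} {n : ℕ} {c : F → ZMod (p ^ n)}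
    (hc : IsTateCocycle θ n c) : F →ₜ* TateSemidirect θ n where
  toFun g := (c g, g)
  map_one' := Prod.ext hc.map_one rfl
  map_mul' a b := Prod.ext (hc.map_mul a b) rfl
  continuous_toFun := hc.continuous.prodMk continuous_id

theorem isTateCocycle_of_section {θ : F →ₜ* ℤ_[p]ˣ} {n : ℕ} (φ : F →ₜ* TateSemidirect θ n)
    (hφ : ∀ g, (φ g).2 = g) : IsTateCocycle θ n fun g => (φ g).1 where
  continuous := continuous_fst.comp φ.continuous_toFun
  map_mul g h := by rw [map_mul, TateSemidirect.fst_mul, hφ]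

namespace IsFreeProPOn

variable [IsTopologicalGroup F] {X : Type u} {ι : X → F} {θ : F →ₜ* ℤ_[p]ˣ} {n : ℕ}

theorem eq_of_isTateCocycle (hF : IsFreeProPOn p ι) {c d : F → ZMod (p ^ n)}
    (hc : IsTateCocycle θ n c) (hd : IsTateCocycle θ n d) (h : ∀ x, c (ι x) = d (ι x)) : c = d := by
  have ht : Tendsto (fun x => hc.toSection (ι x)) cofinite (𝓝 1) := by
    have := (hc.toSection.continuous_toFun.tendsto 1).comp hF.tendsto_one
    rwa [show hc.toSection.toFun 1 = 1 from map_one hc.toSection] at this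
  have := (hF.existsUnique_lift _ (TateSemidirect.isProP hF.isProP) _ ht).unique
    (y₁ := hc.toSection) (y₂ := hd.toSection) (fun _ => rfl) fun x => Prod.ext (h x).symm rfl
  funext g
  exact congrArg Prod.fst (DFunLike.congr_fun this g)

theorem exists_isTateCocycle (hF : IsFreeProPOn p ι) (θ : F →ₜ* ℤ_[p]ˣ) (f : X → ZMod (p ^ n))
    (hf : Tendsto f cofinite (𝓝 0)) : ∃ c, IsTateCocycle θ n c ∧ ∀ x, c (ι x) = f x := by
  let f' : X → TateSemidirect θ n := fun x => (f x, ι x)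
  have ht : Tendsto f' cofinite (𝓝 1) :=
    hf.prodMk_nhds hF.tendsto_one
  obtain ⟨φ, hφ, -⟩ := hF.existsUnique_lift _ (TateSemidirect.isProP hF.isProP) _ ht
  -- The composite with the projection fixes the basis, so it is the identity and `φ` is a section,
  -- that is, a cocycle.
  have h := (hF.existsUnique_lift F hF.isProP ι hF.tendsto_one).unique
    (y₁ := (TateSemidirect.proj θ n).comp φ) (y₂ := ContinuousMonoidHom.id F)
    (fun x => by
      change (φ (ι x)).2 = _
      rw [hφ]) fun _ => rfl
  refine ⟨_, isTateCocycle_of_section φ fun g => DFunLike.congr_fun h g, fun x => ?_⟩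
  rw [hφ]

theorem isKummerian (hF : IsFreeProPOn p ι) (θ : F →ₜ* ℤ_[p]ˣ) : IsKummerian θ := by
  rw [isKummerian_iff]
  intro n hn c hc
  set r := ZMod.castHom (pow_dvd_pow p hn) (ZMod (p ^ 1))
  have hr : Function.Surjective r := ZMod.castHom_surjective _
  -- The set-theoretic section must send `0` to `0` so that the lifted values still converge to `0`
  -- along the basis.
  let s : ZMod (p ^ 1) → ZMod (p ^ n) := fun z => if z = 0 then 0 else Function.surjInv hr z
  have hs : ∀ z, r (s z) = z := fun z => by
    by_cases hz : z = 0
    · simp [s, hz]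
    · simp only [s, hz, if_false, Function.surjInv_eq]
  obtain ⟨d, hd, hdx⟩ := hF.exists_isTateCocycle θ (fun x => s (c (ι x))) (by
    have h1 : Continuous fun g => s (c g) :=
      (continuous_of_discreteTopology (f := s)).comp hc.continuous
    have h2 := (h1.tendsto 1).comp hF.tendsto_one
    rwa [hc.map_one, show s 0 = 0 by simp [s]] at h2)
  refine ⟨d, hd, fun g => ?_⟩
  have hrd : IsTateCocycle θ 1 fun g => r (d g) := by
    refine ⟨continuous_of_discreteTopology.comp hd.continuous, fun g h => ?_⟩
    rw [hd.map_mul, map_add, map_mul, ← RingHom.comp_apply r,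
      PadicInt.zmod_cast_comp_toZModPow 1 n hn]
  exact congrFun (hF.eq_of_isTateCocycle hrd hc fun x => by rw [hdx, hs]) g

end IsFreeProPOn

end FreeProP

/-! ### Cocycles on the kernel of a minimal presentation. -/

section Frattini

variable {p : ℕ} [Fact p.Prime] {F : Type u} [Group F] [TopologicalSpace F]

/-- The image in `(ℤ/p)ˣ` has `p`-power order dividing `p - 1`, so mod `p` cocycles are plain
homomorphisms. -/
theorem IsProP.toZModPow_one_orientation (hF : IsProP p F) (θ : F →ₜ* ℤ_[p]ˣ) (g : F) :
    PadicInt.toZModPow 1 (θ g : ℤ_[p]) = 1 := by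
  have hp : p.Prime := Fact.out
  let ψ : F →* (ZMod (p ^ 1))ˣ :=
    (Units.map (PadicInt.toZModPow (p := p) 1 : ℤ_[p] →* ZMod (p ^ 1))).comp θ.toMonoidHom
  have hψ : ∀ g, (ψ g : ZMod (p ^ 1)) = PadicInt.toZModPow 1 (θ g : ℤ_[p]) := fun _ => rfl
  have ho : IsOpen (ψ.ker : Set F) := by
    have := (isOpen_discrete ({1} : Set (ZMod (p ^ 1)))).preimage
      (TateSemidirect.continuous_action θ 1)
    convert! this using 1
    ext x
    simp [MonoidHom.mem_ker, Units.ext_iff, hψ]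
  obtain ⟨k, hk⟩ := hF.index_eq ψ.ker inferInstance ho
  have h1 : p ^ k ∣ p - 1 := by
    have := Subgroup.card_subgroup_dvd_card ψ.range
    rwa [← Subgroup.index_ker, hk, Nat.card_eq_fintype_card, ZMod.card_units_eq_totient, pow_one,
      Nat.totient_prime hp] at this
  have h2 : k = 0 := by
    by_contra h
    have h3 := Nat.le_of_dvd (Nat.sub_pos_of_lt hp.one_lt) ((dvd_pow_self p h).trans h1)
    have := hp.pos
    omega
  rw [h2, pow_zero, Subgroup.index_eq_one] at hk
  have h4 : g ∈ ψ.ker := hk ▸ Subgroup.mem_top g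
  rw [← hψ, MonoidHom.mem_ker.1 h4, Units.val_one]

theorem IsTateCocycle.eq_zero_of_mem_proPFrattini [IsTopologicalGroup F] (hF : IsProP p F)
    {θ : F →ₜ* ℤ_[p]ˣ} {c : F → ZMod (p ^ 1)} (hc : IsTateCocycle θ 1 c) {h : F}
    (hh : h ∈ proPFrattini p F) : c h = 0 := by
  have hadd : ∀ a b, c (a * b) = c a + c b := fun a b => by
    rw [hc.map_mul, hF.toZModPow_one_orientation, one_mul]
  let ψ : F →* Multiplicative (ZMod (p ^ 1)) :=
    { toFun := fun g => Multiplicative.ofAdd (c g)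
      map_one' := congrArg _ hc.map_one
      map_mul' := fun a b => congrArg _ (hadd a b) }
  have hmem : ∀ g, g ∈ ψ.ker ↔ c g = 0 := fun g => Iff.rfl
  have hcl : IsClosed (ψ.ker : Set F) := isClosed_singleton.preimage (t := {0}) hc.continuous
  refine (hmem h).1 (Subgroup.topologicalClosure_minimal _ ?_ hcl hh)
  rw [Subgroup.closure_le, Set.union_subset_iff]
  constructor
  · rintro _ ⟨g, rfl⟩
    change ψ (g ^ p) = 1
    rw [_root_.map_pow]
    change Multiplicative.ofAdd (p • c g) = 1
    have : ((p : ℕ) : ZMod (p ^ 1)) = 0 := by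
      have := ZMod.natCast_self (p ^ 1)
      rwa [pow_one] at this ⊢
    rw [nsmul_eq_mul, this, zero_mul, ofAdd_zero]
  · exact (commutator_eq_closure F ▸ Subgroup.subset_closure : commutatorSet F ⊆ commutator F).trans
      (Abelianization.commutator_subset_ker ψ)

/-- Multiplication by `p` identifies `ℤ/p^n` with `pℤ/p^(n+1)` equivariantly; `d` is `e` divided by
`p`. -/
theorem IsTateCocycle.exists_eq_mul {θ : F →ₜ* ℤ_[p]ˣ} {n : ℕ} {e : F → ZMod (p ^ (n + 1))}
    (he : IsTateCocycle θ (n + 1) e)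
    (h0 : ∀ g, ZMod.castHom (pow_dvd_pow p (Nat.le_add_left 1 n)) (ZMod (p ^ 1)) (e g) = 0) :
    ∃ d : F → ZMod (p ^ n), IsTateCocycle θ n d ∧ ∀ g, d g = 0 → e g = 0 := by
  have hp : p.Prime := Fact.out
  obtain ⟨w, hw⟩ : ∃ w : ZMod (p ^ (n + 1)) → ℕ, ∀ z,
      ZMod.castHom (pow_dvd_pow p (Nat.le_add_left 1 n)) (ZMod (p ^ 1)) z = 0 →
        ((p * w z : ℕ) : ZMod (p ^ (n + 1))) = z := by
    refine ⟨fun z => z.val / p, fun z hz => ?_⟩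
    rw [ZMod.castHom_apply, ZMod.cast_eq_val, ZMod.natCast_eq_zero_iff, pow_one] at hz
    rw [Nat.mul_div_cancel' hz, ZMod.natCast_zmod_val]
  have key : ∀ m : ℤ, ((p * m : ℤ) : ZMod (p ^ (n + 1))) = 0 ↔ (m : ZMod (p ^ n)) = 0 := fun m => by
    rw [ZMod.intCast_zmod_eq_zero_iff_dvd, ZMod.intCast_zmod_eq_zero_iff_dvd]
    push_cast
    rw [pow_succ', mul_dvd_mul_iff_left (by exact_mod_cast hp.ne_zero)]
  refine ⟨fun g => (w (e g) : ZMod (p ^ n)), ⟨?_, fun g h => ?_⟩, fun g hg => ?_⟩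
  · exact (continuous_of_discreteTopology
      (f := fun z : ZMod (p ^ (n + 1)) => (w z : ZMod (p ^ n)))).comp he.continuous
  · obtain ⟨A, hA⟩ := ZMod.intCast_surjective (PadicInt.toZModPow (n + 1) (θ g : ℤ_[p]))
    have hA' : PadicInt.toZModPow n (θ g : ℤ_[p]) = A := by
      rw [← PadicInt.zmod_cast_comp_toZModPow n (n + 1) n.le_succ, RingHom.comp_apply, ← hA,
        map_intCast]
    have h1 := he.map_mul g h
    rw [← hw _ (h0 (g * h)), ← hw _ (h0 g), ← hw _ (h0 h), ← hA] at h1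
    have h2 := (key ((w (e (g * h)) : ℤ) - (w (e g) : ℤ) - A * (w (e h) : ℤ))).1 (by
      push_cast at h1 ⊢
      linear_combination h1)
    rw [hA']
    push_cast at h2 ⊢
    linear_combination h2
  · rw [← hw _ (h0 g)]
    exact_mod_cast (key (w (e g) : ℤ)).2 (by exact_mod_cast hg)

/-- Modulo `p`, `c` kills `Φ(F)` and so comes from `G`, where it lifts to level `n + 1`. Subtracting
the inflated lift, which vanishes on the kernel, leaves a multiple of `p`, to which the level `n`
case applies. -/
theorem IsKummerian.eq_zero_of_mem_ker [IsTopologicalGroup F] (hF : IsProP p F) {G : Type v}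
    [Group G] [TopologicalSpace G] {θ : G →ₜ* ℤ_[p]ˣ} {θF : F →ₜ* ℤ_[p]ˣ} {π : F →* G}
    (hK : IsKummerian θ) (hπ : IsQuotientMap π) (hθ : ∀ x, θ (π x) = θF x)
    (hker : π.ker ≤ proPFrattini p F) {n : ℕ} {c : F → ZMod (p ^ n)} (hc : IsTateCocycle θF n c)
    {r : F} (hr : r ∈ π.ker) : c r = 0 := by
  induction n with
  | zero => exact Subsingleton.elim (α := ZMod 1) _ _
  | succ n ih =>
    set q := ZMod.castHom (pow_dvd_pow p (Nat.le_add_left 1 n)) (ZMod (p ^ 1))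
    have hqc : IsTateCocycle θF 1 fun g => q (c g) := by
      refine ⟨continuous_of_discreteTopology.comp hc.continuous, fun g h => ?_⟩
      rw [hc.map_mul, map_add, map_mul, ← RingHom.comp_apply q,
        PadicInt.zmod_cast_comp_toZModPow 1 _ (Nat.le_add_left 1 n)]
    obtain ⟨c', hc', hcc⟩ := hqc.exists_descent hπ hθ
      fun x hx => hqc.eq_zero_of_mem_proPFrattini hF (hker hx)
    obtain ⟨d, hd, hdc⟩ := isKummerian_iff.1 hK _ (Nat.le_add_left 1 n) c' hc'
    have hdF := hd.comp hπ.continuous hθ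
    have he : IsTateCocycle θF (n + 1) fun g => c g - d (π g) := by
      refine ⟨hc.continuous.sub hdF.continuous, fun g h => ?_⟩
      have := hdF.map_mul g h
      simp only [Function.comp_apply] at this
      rw [hc.map_mul, this]
      ring
    obtain ⟨e, he', hee⟩ := he.exists_eq_mul fun g => by
      rw [map_sub, hdc, hcc, sub_self]
    have h1 := hee r (ih he')
    have h2 : d (π r) = 0 := by rw [MonoidHom.mem_ker.1 hr, hd.map_one]
    rwa [h2, sub_zero] at h1

end Frattini

/-! ### Torsion-free images are procyclic, and the orientation splits. -/

section TopologicalGenerator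

/-- The class of `5` generates: it keeps its order `2 ^ n` in the quotient, since powers of `5` are
`1` mod `4` and never `-1`. -/
theorem ZMod.isCyclic_units_two_pow_quotient (n : ℕ) :
    IsCyclic ((ZMod (2 ^ (n + 2)))ˣ ⧸ Subgroup.zpowers (-1 : (ZMod (2 ^ (n + 2)))ˣ)) := by
  have h4 : (4 : ℕ) ∣ 2 ^ (n + 2) := ⟨2 ^ n, by ring⟩
  have hmem : ∀ u : (ZMod (2 ^ (n + 2)))ˣ, u ∈ Subgroup.zpowers (-1 : (ZMod (2 ^ (n + 2)))ˣ) ↔ u = 1 ∨ u = -1 := fun u => by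
    constructor
    · rintro ⟨k, rfl⟩
      rcases Int.even_or_odd k with hk | hk
      · exact Or.inl hk.neg_one_zpow
      · exact Or.inr hk.neg_one_zpow
    · rintro (rfl | rfl)
      · exact one_mem _
      · exact Subgroup.mem_zpowers _
  have hne : (-1 : (ZMod (2 ^ (n + 2)))ˣ) ≠ 1 := fun h => by
    have h1 : (-1 : ZMod (2 ^ (n + 2))) = 1 := by simpa using congrArg Units.val h
    have h2 := congrArg (ZMod.castHom h4 (ZMod 4)) h1
    rw [map_neg, map_one] at h2
    exact absurd h2 (by decide)
  have hcard : Nat.card ((ZMod (2 ^ (n + 2)))ˣ ⧸ Subgroup.zpowers (-1 : (ZMod (2 ^ (n + 2)))ˣ)) = 2 ^ n := by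
    have h1 := Subgroup.card_eq_card_quotient_mul_card_subgroup (Subgroup.zpowers (-1 : (ZMod (2 ^ (n + 2)))ˣ))
    rw [Nat.card_zpowers, orderOf_eq_prime (p := 2) (by simp) hne, Nat.card_eq_fintype_card,
      ZMod.card_units_eq_totient, Nat.totient_prime_pow_succ Nat.prime_two] at h1
    rw [pow_succ] at h1
    omega
  have h5u : IsUnit (5 : ZMod (2 ^ (n + 2))) := by
    have : ((5 : ℕ) : ZMod (2 ^ (n + 2))) = 5 := by norm_num
    rw [← this, ZMod.isUnit_iff_coprime]
    exact Nat.Coprime.pow_right _ (by norm_num)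
  obtain ⟨w, hw⟩ := h5u
  refine isCyclic_of_orderOf_eq_card (QuotientGroup.mk w) ?_
  rw [hcard, ← ZMod.orderOf_five n, ← hw, orderOf_units]
  refine orderOf_eq_orderOf_iff.2 fun k => ?_
  rw [← QuotientGroup.mk_pow, QuotientGroup.eq_one_iff, hmem]
  refine or_iff_left fun h => ?_
  have h1 : (5 : ZMod (2 ^ (n + 2))) ^ k = -1 := by
    rw [← hw]
    simpa using congrArg Units.val h
  have h2 := congrArg (ZMod.castHom h4 (ZMod 4)) h1
  rw [map_pow, map_neg, map_one, map_ofNat, show (5 : ZMod 4) = 1 from rfl, one_pow] at h2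
  exact absurd h2 (by decide)

/-- For `p = 2` the subgroup embeds in the cyclic quotient by `±1`; at levels `0` and `1` the
hypothesis fails because `-1 = 1`. -/
theorem ZMod.isCyclic_of_neg_one_notMem {p : ℕ} [hp : Fact p.Prime] {n : ℕ}
    (H : Subgroup (ZMod (p ^ n))ˣ) (h : p = 2 → -1 ∉ H) : IsCyclic H := by
  rcases eq_or_ne p 2 with rfl | hp2
  · match n with
    | 0 => exact absurd (Subsingleton.elim (α := (ZMod 1)ˣ) 1 (-1) ▸ H.one_mem) (h rfl)
    | 1 =>
      have h0 : (1 : ZMod 2) = -1 := rfl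
      have h1 : (1 : (ZMod (2 ^ 1))ˣ) = -1 := Units.ext h0
      exact absurd (h1 ▸ H.one_mem) (h rfl)
    | n + 2 =>
      have := ZMod.isCyclic_units_two_pow_quotient n
      refine isCyclic_of_injective ((QuotientGroup.mk' (Subgroup.zpowers
        (-1 : (ZMod (2 ^ (n + 2)))ˣ))).comp H.subtype) ((injective_iff_map_eq_one _).2 ?_)
      rintro ⟨u, hu⟩ h1
      obtain ⟨k, hk⟩ := (QuotientGroup.eq_one_iff u).1 h1
      rcases Int.even_or_odd k with hk' | hk'
      · exact Subtype.ext (hk.symm.trans hk'.neg_one_zpow)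
      · exact absurd (hk.symm.trans hk'.neg_one_zpow : u = -1) fun h2 => h rfl (h2 ▸ hu)
  · have := ZMod.isCyclic_units_of_prime_pow p hp.out hp2 n
    infer_instance

variable {p : ℕ} [Fact p.Prime] {F : Type u} [Group F] [TopologicalSpace F]

theorem exists_forall_toZModPow_eq {Y : Type*} [TopologicalSpace Y] [CompactSpace Y]
    {f : Y → ℤ_[p]} (hf : Continuous f) {a : ℤ_[p]}
    (h : ∀ n, ∃ y, PadicInt.toZModPow n (f y) = PadicInt.toZModPow n a) : ∃ y, f y = a := by
  have hcl : ∀ n, IsClosed {y | PadicInt.toZModPow n (f y) = PadicInt.toZModPow n a} := fun n =>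
    isClosed_singleton.preimage ((PadicInt.continuous_toZModPow n).comp hf)
  obtain ⟨y, hy⟩ := IsCompact.nonempty_iInter_of_sequence_nonempty_isCompact_isClosed
    (fun n => {y | PadicInt.toZModPow n (f y) = PadicInt.toZModPow n a}) (fun n y hy => by
      change _ = _
      change _ = _ at hy
      rw [← PadicInt.zmod_cast_comp_toZModPow n (n + 1) n.le_succ, RingHom.comp_apply,
        RingHom.comp_apply, hy]) h (hcl 0).isCompact hcl
  exact ⟨y, PadicInt.ext_of_toZModPow.1 (Set.mem_iInter.1 hy)⟩

theorem IsTorsionFreeOrientation.exists_isCyclic_range [CompactSpace F] {θ : F →ₜ* ℤ_[p]ˣ}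
    (hθ : IsTorsionFreeOrientation θ) :
    ∃ N, ∀ n ≥ N, ∃ s : F, ∀ g, ∃ k : ℕ,
      PadicInt.toZModPow n (θ g : ℤ_[p]) = PadicInt.toZModPow n (θ s : ℤ_[p]) ^ k := by
  -- If `-1` were a value modulo every `2 ^ N`, compactness would give `θ g = -1`, a torsion value.
  have hN : ∃ N, p = 2 → ∀ g, PadicInt.toZModPow N (θ g : ℤ_[p]) ≠ -1 := by
    by_contra! hcon
    have hp2 := (hcon 0).1
    obtain ⟨g, hg⟩ := exists_forall_toZModPow_eq (a := (-1 : ℤ_[p]))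
      (Units.continuous_val.comp θ.continuous_toFun) fun n => by
        obtain ⟨-, g, hg⟩ := hcon n
        exact ⟨g, by rw [map_neg, map_one]; exact hg⟩
    have hg' : θ g = -1 := Units.ext (by simpa using hg)
    have h1 := hθ g (isOfFinOrder_iff_pow_eq_one.2 ⟨2, by norm_num, by simp [hg']⟩)
    rw [hg', Units.ext_iff] at h1
    have h2 : (2 : ℤ_[p]) = 0 := by
      simp only [Units.val_neg, Units.val_one] at h1
      linear_combination -h1
    exact two_ne_zero h2
  obtain ⟨N, hN⟩ := hN
  refine ⟨N, fun n hn => ?_⟩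
  let ψ : F →* (ZMod (p ^ n))ˣ :=
    (Units.map (PadicInt.toZModPow (p := p) n : ℤ_[p] →* ZMod (p ^ n))).comp θ.toMonoidHom
  have hψ : ∀ g, (ψ g : ZMod (p ^ n)) = PadicInt.toZModPow n (θ g : ℤ_[p]) := fun _ => rfl
  have hcyc : IsCyclic ψ.range := ZMod.isCyclic_of_neg_one_notMem _ fun hp2 => by
    rintro ⟨g, hg⟩
    refine hN hp2 g ?_
    rw [← PadicInt.zmod_cast_comp_toZModPow N n hn, RingHom.comp_apply, ← hψ, hg, Units.val_neg, Units.val_one,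
      map_neg, map_one]
  obtain ⟨⟨_, s, rfl⟩, hs⟩ := hcyc.exists_monoid_generator
  refine ⟨s, fun g => ?_⟩
  obtain ⟨k, hk⟩ := hs ⟨ψ g, g, rfl⟩
  refine ⟨k, ?_⟩
  rw [← hψ, ← hψ, ← Units.val_pow_eq_pow_val]
  exact congrArg Units.val (congrArg Subtype.val hk).symm

/-- The generators at each level form nested nonempty closed sets in a compact group, so some `s`
works at all levels. -/
theorem IsTorsionFreeOrientation.exists_generator [CompactSpace F] {θ : F →ₜ* ℤ_[p]ˣ}
    (hθ : IsTorsionFreeOrientation θ) :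
    ∃ s : F, ∀ n g, ∃ k : ℕ,
      PadicInt.toZModPow n (θ g : ℤ_[p]) = PadicInt.toZModPow n (θ s : ℤ_[p]) ^ k := by
  obtain ⟨N, hN⟩ := hθ.exists_isCyclic_range
  have hdesc : ∀ {m n : ℕ}, m ≤ n → ∀ {s : F}, (∀ g, ∃ k : ℕ,
      PadicInt.toZModPow n (θ g : ℤ_[p]) = PadicInt.toZModPow n (θ s : ℤ_[p]) ^ k) → ∀ g, ∃ k : ℕ,
      PadicInt.toZModPow m (θ g : ℤ_[p]) = PadicInt.toZModPow m (θ s : ℤ_[p]) ^ k :=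
    fun hmn s h g => (h g).imp fun k hk => by
      rw [← PadicInt.zmod_cast_comp_toZModPow _ _ hmn, RingHom.comp_apply, RingHom.comp_apply, hk,
        map_pow]
  have hcl : ∀ n, IsClosed {s : F | ∀ g, ∃ k : ℕ,
      PadicInt.toZModPow n (θ g : ℤ_[p]) = PadicInt.toZModPow n (θ s : ℤ_[p]) ^ k} := fun n =>
    (isClosed_discrete {z : ZMod (p ^ n) | ∀ g, ∃ k : ℕ,
      PadicInt.toZModPow n (θ g : ℤ_[p]) = z ^ k}).preimage
        (TateSemidirect.continuous_action θ n)
  obtain ⟨s, hs⟩ := IsCompact.nonempty_iInter_of_sequence_nonempty_isCompact_isClosed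
    (fun n => {s : F | ∀ g, ∃ k : ℕ,
      PadicInt.toZModPow n (θ g : ℤ_[p]) = PadicInt.toZModPow n (θ s : ℤ_[p]) ^ k})
    (fun n s hs => hdesc n.le_succ hs)
    (fun n => (hN (max N n) (le_max_left _ _)).imp fun s hs => hdesc (le_max_right _ _) hs)
    (hcl 0).isCompact hcl
  exact ⟨s, Set.mem_iInter.1 hs⟩

/-- The kernel is a closed ideal of `ℤ_p`; containing `a ≠ 0`, it would contain a power of `p`,
making `ψ 1` torsion. -/
theorem padicInt_eq_zero_of_map_eq_one {A : Type*} [CommGroup A] [TopologicalSpace A] [T2Space A]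
    {ψ : ℤ_[p] → A} (hψ : Continuous ψ) (hadd : ∀ a b, ψ (a + b) = ψ a * ψ b)
    (htf : IsOfFinOrder (ψ 1) → ψ 1 = 1) (h1 : ψ 1 ≠ 1) {a : ℤ_[p]} (ha : ψ a = 1) : a = 0 := by
  by_contra hne
  have h0 : ψ 0 = 1 := by simpa using hadd 0 0
  have hnat : ∀ (b : ℤ_[p]) (k : ℕ), ψ (k * b) = ψ b ^ k := fun b k => by
    induction k with
    | zero => simp [h0]
    | succ k ih => rw [Nat.cast_succ, add_mul, one_mul, hadd, ih, pow_succ]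
  have hall : ∀ b : ℤ_[p], ψ (b * a) = 1 := by
    refine fun b => PadicInt.denseRange_natCast.induction_on b ?_ fun k => ?_
    · exact isClosed_singleton.preimage (t := {1}) (hψ.comp (continuous_mul_const a))
    · rw [hnat, ha, one_pow]
  have h2 : ψ ((p ^ a.valuation : ℕ) * 1) = 1 := by
    obtain ⟨w, hw⟩ : ∃ w : ℤ_[p]ˣ, a = w * (p : ℤ_[p]) ^ a.valuation :=
      ⟨_, PadicInt.unitCoeff_spec hne⟩
    have h4 := hall (w⁻¹ : ℤ_[p]ˣ)
    rw [(Units.inv_mul_eq_iff_eq_mul _).2 hw] at h4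
    simpa using h4
  rw [hnat] at h2
  exact h1 (htf (isOfFinOrder_iff_pow_eq_one.2
    ⟨_, pow_pos (Fact.out : p.Prime).pos _, h2⟩))

/-- The image of a torsion-free orientation `θ` of a pro-`p` group `F` is procyclic, hence the
projection `F → F / Ker θ` splits. -/
theorem IsTorsionFreeOrientation.exists_splitting [IsTopologicalGroup F] (hF : IsProP p F)
    {θ : F →ₜ* ℤ_[p]ˣ} (hθ : IsTorsionFreeOrientation θ) :
    ∃ t : F →ₜ* F, (∀ g, θ (t g) = θ g) ∧ ∀ g, θ g = 1 → t g = 1 := by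
  have := hF.compact
  obtain ⟨s, hs⟩ := hθ.exists_generator
  by_cases hs1 : θ s = 1
  · have htriv : ∀ g, θ g = 1 := fun g => Units.ext <| PadicInt.ext_of_toZModPow.1 fun n => by
      obtain ⟨k, hk⟩ := hs n g
      rw [hk, hs1]
      simp
    exact ⟨1, fun g => by rw [htriv, htriv], fun g _ => rfl⟩
  have hcont : Continuous fun a : ℤ_[p] => θ (padicPow s a) :=
    θ.continuous_toFun.comp (hF.continuous_padicPow s)
  have hadd : ∀ a b : ℤ_[p], θ (padicPow s (a + b)) = θ (padicPow s a) * θ (padicPow s b) :=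
    fun a b => by rw [hF.padicPow_add, map_mul]
  have hone : padicPow s (1 : ℤ_[p]) = s := by
    simpa using hF.padicPow_natCast s 1
  have hzero : padicPow s (0 : ℤ_[p]) = 1 := by
    simpa using hF.padicPow_natCast s 0
  have hinj : Function.Injective fun a : ℤ_[p] => θ (padicPow s a) := fun a b hab => by
    rw [← sub_eq_zero]
    refine padicInt_eq_zero_of_map_eq_one hcont hadd (by rw [hone]; exact hθ s)
      (by rwa [hone]) ?_
    have h1 := hadd (a - b) b
    rw [sub_add_cancel] at h1
    simp only at hab
    rw [hab] at h1
    exact (mul_eq_right.1 h1.symm)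
  have hsurj : ∀ g, ∃ a : ℤ_[p], θ (padicPow s a) = θ g := fun g => by
    obtain ⟨a, ha⟩ := exists_forall_toZModPow_eq (a := (θ g : ℤ_[p]))
      (Units.continuous_val.comp hcont) fun n => by
        obtain ⟨k, hk⟩ := hs n g
        exact ⟨k, by simp [hk, hF.padicPow_natCast]⟩
    exact ⟨a, Units.ext ha⟩
  -- `l` is the logarithm of `θ` to the base `θ s`; the splitting is `g ↦ s ^ l(g)`.
  choose l hl using hsurj
  have hlc : Continuous l := by
    rw [(hcont.isClosedEmbedding hinj).isInducing.continuous_iff]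
    exact θ.continuous_toFun.congr fun g => (hl g).symm
  have hlm : ∀ g h, l (g * h) = l g + l h := fun g h => hinj (by
    simp only
    rw [hl, hadd, hl, hl, map_mul])
  have hl0 : ∀ g, θ g = 1 → l g = 0 := fun g hg => hinj (by
    simp only
    rw [hl, hg, hzero, map_one])
  refine ⟨⟨⟨⟨fun g => padicPow s (l g), ?_⟩, fun g h => ?_⟩,
    (hF.continuous_padicPow s).comp hlc⟩, hl, fun g hg => ?_⟩
  · rw [hl0 1 (map_one θ), hzero]
  · change padicPow s (l (g * h)) = padicPow s (l g) * padicPow s (l h)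
    rw [hlm, hF.padicPow_add]
  · change padicPow s (l g) = 1
    rw [hl0 g hg, hzero]

end TopologicalGenerator

/-! ### Characters and cocycles that detect `K(𝒢)`. -/

section Characters

theorem CommGroup.exists_zmod_character {B : Type*} [CommGroup B] [Finite B] {N : ℕ} [NeZero N]
    (hN : ∀ b : B, b ^ N = 1) {b : B} (hb : b ≠ 1) :
    ∃ χ : B →* Multiplicative (ZMod N), χ b ≠ 1 := by
  obtain ⟨φ, hφ⟩ := CommGroup.exists_apply_ne_one_of_hasEnoughRootsOfUnity B ℂ hb
  have hmem : ∀ x, φ x ∈ rootsOfUnity N ℂ := fun x => by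
    rw [mem_rootsOfUnity, ← map_pow, hN, map_one]
  have hcard : Nat.card (rootsOfUnity N ℂ) = N := Complex.card_rootsOfUnity N
  let e : rootsOfUnity N ℂ ≃* Multiplicative (ZMod N) :=
    (hcard ▸ zmodCyclicMulEquiv (G := rootsOfUnity N ℂ) inferInstance).symm
  refine ⟨e.toMonoidHom.comp (φ.codRestrict _ hmem), fun h => hφ ?_⟩
  have h1 : φ.codRestrict _ hmem b = 1 := (map_eq_one_iff e e.injective).1 h
  exact congrArg Subtype.val h1

variable {p : ℕ} [Fact p.Prime] {F : Type u} [Group F] [TopologicalSpace F] [IsTopologicalGroup F]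

theorem IsProP.padicPow_neg_one (hF : IsProP p F) (x : F) : padicPow x (-1 : ℤ_[p]) = x⁻¹ := by
  have h1 := hF.padicPow_add x 1 (-1)
  have h2 := hF.padicPow_natCast x 1
  have h3 := hF.padicPow_natCast x 0
  rw [Nat.cast_one, pow_one] at h2
  rw [Nat.cast_zero, pow_zero] at h3
  rw [add_neg_cancel, h2, h3] at h1
  exact (inv_eq_of_mul_eq_one_right h1.symm).symm

/-- Some open normal `V ⊇ K(𝒢)` misses `h`. The image of `ker θ` in `F / V` is a finite abelian
group on which conjugation by `g` is the power `θ(g)`, so each of its characters is equivariant. -/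
theorem exists_equivariant_character (hF : IsProP p F) (θ : F →ₜ* ℤ_[p]ˣ) {h : F}
    (hh : θ h = 1) (hK : h ∉ kSubgroup θ) :
    ∃ (n : ℕ) (ψ : θ.toMonoidHom.ker →* Multiplicative (ZMod (p ^ n))), Continuous ψ ∧
      (∀ (g : F) (x y : θ.toMonoidHom.ker), (y : F) = g * x * g⁻¹ →
        (ψ y).toAdd = PadicInt.toZModPow n (θ g : ℤ_[p]) * (ψ x).toAdd) ∧ ψ ⟨h, hh⟩ ≠ 1 := by
  have := kSubgroup_normal hF θ
  obtain ⟨U, hU, hUo, hUW⟩ := hF.exists_openNormal_le (W := {x | h * x⁻¹ ∉ kSubgroup θ}) (by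
    have hc : Continuous fun x : F => h * x⁻¹ := by fun_prop
    exact ((isClosed_kSubgroup θ).isOpen_compl.preimage hc).mem_nhds (by simpa using hK))
  set V := kSubgroup θ ⊔ U with hV
  have hVo : IsOpen (V : Set F) := Subgroup.isOpen_mono le_sup_right hUo
  have hVn : V.Normal := Subgroup.sup_normal _ _
  have hKV : kSubgroup θ ≤ V := le_sup_left
  have hhV : h ∉ V := fun hmem => by
    obtain ⟨k, hk, u, hu, rfl⟩ := Subgroup.mem_sup_of_normal_right.1 hmem
    exact hUW hu (by simpa using hk)
  obtain ⟨n, hn⟩ := hF.index_eq V hVn hVo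
  have := hF.compact
  have hfin : Finite (F ⧸ V) := Subgroup.quotient_finite_of_isOpen V hVo
  have hdisc : DiscreteTopology (F ⧸ V) := QuotientGroup.discreteTopology hVo
  let f : θ.toMonoidHom.ker →* F ⧸ V := (QuotientGroup.mk' V).comp θ.toMonoidHom.ker.subtype
  have hf : ∀ x, f x = QuotientGroup.mk (x : F) := fun _ => rfl
  have hcomm : ∀ a b : f.range, a * b = b * a := by
    rintro ⟨_, a, rfl⟩ ⟨_, b, rfl⟩
    refine Subtype.ext (QuotientGroup.eq.2 ?_ : f a * f b = f b * f a)
    have ha := mem_orientation_ker.1 a.2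
    -- For `a`, `b` in `ker θ` the generator attached to `(a⁻¹, b)` is the commutator `b⁻¹ a⁻¹ b a`.
    have h1 := hKV (mem_kSubgroup (θ := θ) (a⁻¹ : F) (mem_orientation_ker.1 b.2))
    rw [map_inv, ha, inv_one, Units.val_one, hF.padicPow_neg_one, inv_inv] at h1
    change (a * b : F)⁻¹ * (b * a) ∈ V
    simpa [mul_assoc] using h1
  let : CommGroup f.range := { (inferInstance : Group f.range) with mul_comm := hcomm }
  obtain ⟨χ, hχ⟩ := CommGroup.exists_zmod_character (B := f.range) (N := p ^ n)
    (fun b => Subtype.ext (by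
      obtain ⟨y, hy⟩ := QuotientGroup.mk_surjective (b : F ⧸ V)
      change (b : F ⧸ V) ^ p ^ n = 1
      rw [← hy, ← hn, ← QuotientGroup.mk_pow, QuotientGroup.eq_one_iff]
      exact V.pow_index_mem y)) (b := f.rangeRestrict ⟨h, hh⟩) (fun h1 => hhV
        ((QuotientGroup.eq_one_iff h).1 (congrArg Subtype.val h1)))
  have hψf : ∀ x y, f x = f y → χ (f.rangeRestrict x) = χ (f.rangeRestrict y) := fun x y hxy =>
    congrArg χ (Subtype.ext hxy)
  refine ⟨n, χ.comp f.rangeRestrict, ?_, fun g x y hy => ?_, hχ⟩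
  · refine (continuous_of_discreteTopology (f := χ)).comp (Continuous.subtype_mk ?_ _)
    exact continuous_quotient_mk'.comp continuous_subtype_val
  · have hx := mem_orientation_ker.1 x.2
    obtain ⟨k, hk, hka⟩ := hF.exists_pow_eq_padicPow (x : F) (-(θ g : ℤ_[p])) n
      (W := {z | (QuotientGroup.mk z : F ⧸ V) = QuotientGroup.mk (padicPow (x : F) (-(θ g : ℤ_[p])))})
      (((isOpen_discrete {_}).preimage continuous_quotient_mk').mem_nhds rfl)
    have h1 := (QuotientGroup.eq_one_iff _).2 (hKV (mem_kSubgroup (θ := θ) g hx))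
    rw [QuotientGroup.mk_mul, ← hk, ← hy, ← QuotientGroup.mk_mul] at h1
    have h2 := hψf (x ^ k * y) 1 h1
    have h3 := congrArg Multiplicative.toAdd h2
    simp only [map_mul, map_pow, map_one, toAdd_mul, toAdd_pow, toAdd_one, nsmul_eq_mul, hka,
      map_neg] at h3
    simp only [MonoidHom.comp_apply]
    linear_combination h3

/-- Cocycles with values in the modules `ℤ_p(1)/p^n` detect membership in `K(𝒢)`. -/
theorem IsTorsionFreeOrientation.mem_kSubgroup_of_forall_isTateCocycle (hF : IsProP p F)
    {θ : F →ₜ* ℤ_[p]ˣ} (hθ : IsTorsionFreeOrientation θ) {h : F} (hh : θ h = 1)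
    (H : ∀ (n : ℕ) (c : F → ZMod (p ^ n)), IsTateCocycle θ n c → c h = 0) : h ∈ kSubgroup θ := by
  by_contra hK
  obtain ⟨n, ψ, hψ, hequiv, hne⟩ := exists_equivariant_character hF θ hh hK
  obtain ⟨t, ht, ht1⟩ := hθ.exists_splitting hF
  have hker : ∀ g, g * (t g)⁻¹ ∈ θ.toMonoidHom.ker := fun g => by
    rw [mem_orientation_ker, map_mul, map_inv, ht, mul_inv_cancel]
  -- Extend `ψ` by composing it with the retraction `g ↦ g * (t g)⁻¹` onto `ker θ`.
  have hc : IsTateCocycle θ n fun g => (ψ ⟨g * (t g)⁻¹, hker g⟩).toAdd := by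
    refine ⟨?_, fun a b => ?_⟩
    · have h1 : Continuous fun g => g * (t g)⁻¹ := continuous_id.mul t.continuous_toFun.inv
      exact continuous_of_discreteTopology.comp (hψ.comp (h1.subtype_mk hker))
    · have hab : (⟨a * b * (t (a * b))⁻¹, hker (a * b)⟩ : θ.toMonoidHom.ker) =
          ⟨a * (b * (t b)⁻¹) * a⁻¹, Subgroup.Normal.conj_mem inferInstance _ (hker b) a⟩ *
            ⟨a * (t a)⁻¹, hker a⟩ := Subtype.ext (by
        simp only [map_mul, Subgroup.coe_mul]
        group)
      rw [hab, map_mul, toAdd_mul, hequiv a ⟨b * (t b)⁻¹, hker b⟩ _ rfl, add_comm]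
  refine hne (Multiplicative.toAdd.injective ?_)
  have h1 := H n _ hc
  simp only [ht1 h hh, inv_one, mul_one] at h1
  exact h1

end Characters

/-! ### Minimal presentations and the corollary. -/

section MinimalPresentation

variable {p : ℕ} {F : Type v} [Group F] [TopologicalSpace F]
  {G : Type u} [Group G] [TopologicalSpace G] {π : F →ₜ* G}

theorem IsMinimalPresentation.isProP [IsTopologicalGroup F] (hπ : IsMinimalPresentation p π) :
    IsProP p F :=
  let ⟨_, _, h⟩ := hπ.free
  h.isProP

theorem IsMinimalPresentation.isQuotientMap [IsTopologicalGroup F]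
    (hπ : IsMinimalPresentation p π) (hG : IsProP p G) :
    IsQuotientMap π := by
  have := hπ.isProP.compact
  have := hG.t2Space
  exact π.continuous_toFun.isClosedMap.isQuotientMap π.continuous_toFun hπ.surjective

variable [Fact p.Prime]

theorem IsTorsionFreeOrientation.comp {θ : G →ₜ* ℤ_[p]ˣ} (hθ : IsTorsionFreeOrientation θ)
    (π : F →ₜ* G) : IsTorsionFreeOrientation (θ.comp π) := fun x hx => hθ (π x) hx

theorem exists_orientation_comp_eq {θ' : F →ₜ* ℤ_[p]ˣ} (hπ : IsQuotientMap π)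
    (hker : π.toMonoidHom.ker ≤ θ'.toMonoidHom.ker) : ∃ θ : G →ₜ* ℤ_[p]ˣ, θ.comp π = θ' := by
  let φ : G →* ℤ_[p]ˣ := π.toMonoidHom.liftOfSurjective hπ.surjective ⟨θ'.toMonoidHom, hker⟩
  have hφ : ∀ x, φ (π x) = θ' x := fun x =>
    MonoidHom.liftOfRightInverse_comp_apply _ _ _ ⟨θ'.toMonoidHom, hker⟩ x
  refine ⟨⟨φ, hπ.continuous_iff.2 (θ'.continuous_toFun.congr fun x => (hφ x).symm)⟩, ?_⟩
  ext x : 1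
  exact hφ x

namespace IsMinimalPresentation

variable [IsTopologicalGroup F]

theorem isKummerian_iff (hπ : IsMinimalPresentation p π) (hG : IsProP p G) {θ : G →ₜ* ℤ_[p]ˣ}
    (hθ : IsTorsionFreeOrientation θ) :
    IsKummerian θ ↔ π.toMonoidHom.ker ≤ kSubgroup (θ.comp π) := by
  have hq := hπ.isQuotientMap hG
  constructor
  · intro hK r hr
    refine (hθ.comp π).mem_kSubgroup_of_forall_isTateCocycle hπ.isProP ?_ fun n c hc =>
      hK.eq_zero_of_mem_ker hπ.isProP (π := π.toMonoidHom) hq (fun _ => rfl) hπ.ker_le hc hr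
    change θ (π r) = 1
    rw [show π r = 1 from hr, map_one]
  · intro hker
    obtain ⟨X, ι, hF⟩ := hπ.free
    exact (isKummerian_iff_of_ker_le_kSubgroup hπ.isProP (π := π.toMonoidHom) hq
      (fun _ => rfl) hker).1 (hF.isKummerian _)

end IsMinimalPresentation

end MinimalPresentation

theorem corollary6p11 (p : ℕ) [Fact p.Prime] (G : Type u) [Group G] [TopologicalSpace G]
    [IsTopologicalGroup G] (hG : IsProP p G) :
    -- Kummerianity of a torsion-free pair and of its quotient by `N ⊆ K(𝒢)`
    (∀ θ : G →ₜ* ℤ_[p]ˣ, IsTorsionFreeOrientation θ →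
      ∀ (N : Subgroup G) [N.Normal], IsClosed (N : Set G) → N ≤ kSubgroup θ →
        ∃ hN : N ≤ θ.toMonoidHom.ker,
          (IsKummerian θ ↔ IsKummerian (quotientOrientation θ N hN))) ∧
    -- minimal presentations `G = F/R`, with `R` the kernel of `π`
    (∀ (F : Type v) [Group F] [TopologicalSpace F] [IsTopologicalGroup F] (π : F →ₜ* G),
      IsMinimalPresentation p π →
        (∀ θ : G →ₜ* ℤ_[p]ˣ, IsTorsionFreeOrientation θ →
          (IsKummerian θ ↔ π.toMonoidHom.ker ≤ kSubgroup (θ.comp π))) ∧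
        ((∃ θ : G →ₜ* ℤ_[p]ˣ, IsTorsionFreeOrientation θ ∧ IsKummerian θ) ↔
          ∃ θ' : F →ₜ* ℤ_[p]ˣ, IsTorsionFreeOrientation θ' ∧
            π.toMonoidHom.ker ≤ kSubgroup θ')) := by
  refine ⟨fun θ _ N _ hN hNK => ⟨hNK.trans (kSubgroup_le_ker hG θ), ?_⟩, fun F _ _ _ π hπ => ?_⟩
  · exact isKummerian_iff_of_ker_le_kSubgroup hG (π := QuotientGroup.mk' N)
      (QuotientGroup.isQuotientMap_mk N) (fun _ => rfl) (by rwa [QuotientGroup.ker_mk'])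
  · have hquot := hπ.isQuotientMap hG
    refine ⟨fun θ hθ => hπ.isKummerian_iff hG hθ, fun ⟨θ, hθ, hK⟩ => ?_, fun ⟨θ', hθ', hK⟩ => ?_⟩
    · exact ⟨θ.comp π, hθ.comp π, (hπ.isKummerian_iff hG hθ).1 hK⟩
    -- Since `R ⊆ K ⊆ ker θ'`, the orientation of `F` factors through `G`.
    · obtain ⟨θ, rfl⟩ := exists_orientation_comp_eq hquot
        (hK.trans (kSubgroup_le_ker hπ.isProP θ'))
      have hθ : IsTorsionFreeOrientation θ := fun g hg => by
        obtain ⟨x, rfl⟩ := hπ.surjective g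
        exact hθ' x hg
      exact ⟨θ, hθ, (hπ.isKummerian_iff hG hθ).2 hK⟩
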